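/- Let $q$ be a complex number with $|q|<1$. Write $(a;q)_n=\prod_{k=0}^{n-1}(1-aq^k)$ and $(a;q)_\infty=\lim_{n\to\infty}(a;q)_n=\prod_{k=0}^{\infty}(1-aq^k)$, and let $$\phi(q)=\sum_{n=0}^{\infty}\frac{q^{n^2}}{(-q^2;q^2)_n}$$ be the third order mock theta function. Then the series defining $\phi(q)$ and the series on the left below converge absolutely, and $$1+\frac{q}{(-q;q^2)_\infty}\sum_{n=0}^{\infty}q^n(-q^{n+1};q)_n(-q^{2n+1};q^2)_\infty=\frac{1-\phi(q)}{(-q;q^2)_\infty}+(q^2;q^2)_\infty(-q;q^2)_\infty^2 .$$ Moreover, the terms with $n\ge 1$ of the series on the left form the generating function of the partitions in question: if $p(n)$ denotes the number of nonempty partitions of $n$ into distinct parts in which each even part is at most twice the smallest part, then $$\sum_{n=1}^{\infty}p(n)q^n=\sum_{n=1}^{\infty}q^n(-q^{n+1};q)_n(-q^{2n+1};q^2)_\infty ,$$ the series on the left converging absolutely. -/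

import Mathlib

/-- The finite `q`-shifted factorial `(a; q)_n = ∏_{k=0}^{n-1} (1 - a q^k)`. -/
noncomputable def qPoch (a q : ℂ) (n : ℕ) : ℂ :=
  ∏ k ∈ Finset.range n, (1 - a * q ^ k)

/-- The infinite `q`-shifted factorial `(a; q)_∞ = ∏_{k=0}^∞ (1 - a q^k)`. For `‖q‖ < 1` it is the
limit of `(a; q)_n` as `n → ∞`, see `tendsto_qPoch`. -/
noncomputable def qPochInf (a q : ℂ) : ℂ :=
  ∏' k : ℕ, (1 - a * q ^ k)

theorem tendsto_qPoch (a q : ℂ) (hq : ‖q‖ < 1) :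
    Filter.Tendsto (fun n => qPoch a q n) Filter.atTop (nhds (qPochInf a q)) := by
  have hs : Summable (fun k : ℕ => ‖-(a * q ^ k)‖) := by
    simp only [norm_neg, norm_mul, norm_pow]
    exact (summable_geometric_of_lt_one (norm_nonneg q) hq).mul_left _
  have hm : Multipliable (fun k : ℕ => 1 - a * q ^ k) := by
    simpa [sub_eq_add_neg] using multipliable_one_add_of_summable hs
  exact hm.tendsto_prod_tprod_nat

/-- The third order mock theta function `φ(q) = ∑_{n ≥ 0} q^(n²) / (-q²; q²)_n`. -/
noncomputable def mockPhi (q : ℂ) : ℂ :=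
  ∑' n : ℕ, q ^ (n ^ 2) / qPoch (-q ^ 2) (q ^ 2) n

/-- A (necessarily nonempty) partition into distinct parts, in which each even part is at most twice
the smallest part. -/
def IsDistinctEvenBounded {n : ℕ} (p : n.Partition) : Prop :=
  p.parts.Nodup ∧
    ∃ s ∈ p.parts, (∀ i ∈ p.parts, s ≤ i) ∧ ∀ i ∈ p.parts, Even i → i ≤ 2 * s

/-- The number of nonempty partitions of `n` into distinct parts, in which each even part is at most
twice the smallest part. -/
noncomputable def distinctEvenBoundedCount (n : ℕ) : ℕ :=
  Nat.card {p : n.Partition // IsDistinctEvenBounded p}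

section
open Filter Topology Finset

/-! ### Elementary facts on `q`-shifted factorials -/

/-! Write A = (-q;q²)_∞ and H = ∑ q^m (-1;q²)_m. After multiplication by A the identity follows from
two formulas for H: A + q∑(smallest-part series) = H (`qPochInf_add_tsum_smallest_part`) and φ(q) +
H - 1 = (q²;q²)_∞ A³ (`mockPhi_add_tsum`).

For the first, multiplication by (-1;q²)_∞ turns the left side into ∑ q^m (-1;q²)_m (-q^m;q)_∞.
Euler's expansion of the last factor, followed by `tsum_pow_mul_qPoch_neg_one` for the sum over m,
gives a double series in (j, k). Its even-j and odd-j parts are the two halves, on either side of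
the diagonal, of a product of two series with values (-1;q²)_∞ and H.

For the second, ∑_{n∈ℤ} q^(n²) (-w q^(2n+2);q²)_∞ factors as ∑ q^(n²) times an Euler series in w. At
w = 1 its two halves are φ and H - 1 up to a common factor; at w = -1 the negative half vanishes and
the theta series is evaluated.

The generating function comes from summing ∏ q^j over the admissible sets of parts, grouped by total
and by smallest part. -/

theorem qPoch_succ (a q : ℂ) (n : ℕ) : qPoch a q (n + 1) = qPoch a q n * (1 - a * q ^ n) :=
  prod_range_succ _ _

@[simp] theorem qPoch_zero (a q : ℂ) : qPoch a q 0 = 1 := prod_range_zero _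

theorem qPoch_add (a q : ℂ) (m n : ℕ) :
    qPoch a q (m + n) = qPoch a q m * qPoch (a * q ^ m) q n := by
  simp only [qPoch, prod_range_add, pow_add, mul_assoc]

theorem qPoch_two_mul (a q : ℂ) (n : ℕ) :
    qPoch a q (2 * n) = qPoch a (q ^ 2) n * qPoch (a * q) (q ^ 2) n := by
  induction n with
  | zero => simp
  | succ n ih => rw [mul_add, mul_one, qPoch_succ, qPoch_succ, ih, qPoch_succ, qPoch_succ]; ring

theorem qPoch_mul_neg (a q : ℂ) (n : ℕ) :
    qPoch a q n * qPoch (-a) q n = qPoch (a ^ 2) (q ^ 2) n := by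
  simp only [qPoch, ← prod_mul_distrib]
  exact prod_congr rfl fun k _ => by ring

theorem norm_sq_lt_one {q : ℂ} (hq : ‖q‖ < 1) : ‖q ^ 2‖ < 1 := by
  rw [norm_pow]; exact pow_lt_one₀ (norm_nonneg _) hq two_ne_zero

theorem norm_mul_pow_lt_one {a q : ℂ} (ha : ‖a‖ < 1) (hq : ‖q‖ < 1) (k : ℕ) : ‖a * q ^ k‖ < 1 := by
  rw [norm_mul, norm_pow]
  exact mul_lt_one_of_nonneg_of_lt_one_left (norm_nonneg _) ha
    (pow_le_one₀ (norm_nonneg _) hq.le)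

theorem one_sub_ne_zero_of_norm_lt_one {x : ℂ} (hx : ‖x‖ < 1) : 1 - x ≠ 0 := by
  intro h
  rw [← sub_eq_zero.1 h] at hx
  simp at hx

theorem qPoch_ne_zero {a q : ℂ} (ha : ‖a‖ < 1) (hq : ‖q‖ < 1) (n : ℕ) : qPoch a q n ≠ 0 :=
  prod_ne_zero_iff.2 fun k _ => one_sub_ne_zero_of_norm_lt_one (norm_mul_pow_lt_one ha hq k)

theorem summable_norm_neg_mul_pow (a : ℂ) {q : ℂ} (hq : ‖q‖ < 1) :
    Summable (fun k : ℕ => ‖-(a * q ^ k)‖) := by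
  simp only [norm_neg, norm_mul, norm_pow]
  exact (summable_geometric_of_lt_one (norm_nonneg q) hq).mul_left _

theorem qPochInf_ne_zero {a q : ℂ} (ha : ‖a‖ < 1) (hq : ‖q‖ < 1) : qPochInf a q ≠ 0 := by
  have := tprod_one_add_ne_zero_of_summable (f := fun k : ℕ => -(a * q ^ k))
    (fun k => by
      rw [← sub_eq_add_neg]
      exact one_sub_ne_zero_of_norm_lt_one (norm_mul_pow_lt_one ha hq k))
    (summable_norm_neg_mul_pow a hq)
  simpa only [qPochInf, ← sub_eq_add_neg] using this

theorem exists_norm_le_of_tendsto {u : ℕ → ℂ} {l : ℂ} (h : Tendsto u atTop (𝓝 l)) :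
    ∃ C, 0 ≤ C ∧ ∀ n, ‖u n‖ ≤ C := by
  obtain ⟨C, hC⟩ := h.norm.bddAbove_range
  exact ⟨C, (norm_nonneg _).trans (hC ⟨0, rfl⟩), fun n => hC ⟨n, rfl⟩⟩

theorem exists_norm_qPoch_le (a : ℂ) {q : ℂ} (hq : ‖q‖ < 1) :
    ∃ C, 0 ≤ C ∧ ∀ n, ‖qPoch a q n‖ ≤ C :=
  exists_norm_le_of_tendsto (tendsto_qPoch a q hq)

theorem exists_norm_qPoch_inv_le {a q : ℂ} (ha : ‖a‖ < 1) (hq : ‖q‖ < 1) :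
    ∃ C, 0 ≤ C ∧ ∀ n, ‖(qPoch a q n)⁻¹‖ ≤ C :=
  exists_norm_le_of_tendsto ((tendsto_qPoch a q hq).inv₀ (qPochInf_ne_zero ha hq))

theorem qPochInf_eq_qPoch_mul (a : ℂ) {q : ℂ} (hq : ‖q‖ < 1) (n : ℕ) :
    qPochInf a q = qPoch a q n * qPochInf (a * q ^ n) q := by
  refine tendsto_nhds_unique ((tendsto_qPoch a q hq).comp (tendsto_add_atTop_nat n)) ?_
  refine ((tendsto_qPoch (a * q ^ n) q hq).const_mul (qPoch a q n)).congr fun m => ?_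
  rw [Function.comp_apply, ← qPoch_add, add_comm]

theorem qPochInf_eq_one_sub_mul (a : ℂ) {q : ℂ} (hq : ‖q‖ < 1) :
    qPochInf a q = (1 - a) * qPochInf (a * q) q := by
  rw [qPochInf_eq_qPoch_mul a hq 1]; simp [qPoch]

theorem qPochInf_eq_even_mul_odd (a : ℂ) {q : ℂ} (hq : ‖q‖ < 1) :
    qPochInf a q = qPochInf a (q ^ 2) * qPochInf (a * q) (q ^ 2) := by
  refine tendsto_nhds_unique ((tendsto_qPoch a q hq).comp
    (tendsto_id.const_mul_atTop' (two_pos : (0 : ℕ) < 2))) ?_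
  refine ((tendsto_qPoch a _ (norm_sq_lt_one hq)).mul
    (tendsto_qPoch (a * q) _ (norm_sq_lt_one hq))).congr fun n => ?_
  simp [qPoch_two_mul]

theorem qPochInf_mul_neg (a : ℂ) {q : ℂ} (hq : ‖q‖ < 1) :
    qPochInf a q * qPochInf (-a) q = qPochInf (a ^ 2) (q ^ 2) := by
  refine tendsto_nhds_unique ((tendsto_qPoch a q hq).mul (tendsto_qPoch (-a) q hq)) ?_
  exact (tendsto_qPoch _ _ (norm_sq_lt_one hq)).congr fun n => (qPoch_mul_neg a q n).symm

/-- Euler's product identity `(q; q²)_∞ (-q; q²)_∞ (-q²; q²)_∞ = 1`. -/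
theorem qPochInf_euler {q : ℂ} (hq : ‖q‖ < 1) :
    qPochInf q (q ^ 2) * (qPochInf (-q) (q ^ 2) * qPochInf (-q ^ 2) (q ^ 2)) = 1 := by
  have h1 := qPochInf_eq_even_mul_odd q hq
  have h2 := qPochInf_eq_even_mul_odd (-q) hq
  have h3 := qPochInf_mul_neg q hq
  have h4 := qPochInf_ne_zero (norm_sq_lt_one hq) (norm_sq_lt_one hq)
  -- Splitting both factors of (q;q)_∞ (-q;q)_∞ = (q²;q²)_∞ by parity leaves (q²;q²)_∞ on both
  -- sides, to be cancelled.
  rw [h1, h2, show -q * q = -q ^ 2 by ring, show q * q = q ^ 2 by ring] at h3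
  refine mul_right_cancel₀ h4 ?_
  linear_combination h3

/-! ### Euler's two expansions -/

theorem two_mul_choose_two_add (n : ℕ) : 2 * n.choose 2 + n = n ^ 2 := by
  induction n with
  | zero => rfl
  | succ n ih => rw [Nat.choose_succ_succ' n 1, Nat.choose_one_right]; linarith [add_sq n 1]

theorem choose_succ_two (n : ℕ) : (n + 1).choose 2 = n.choose 2 + n := by
  rw [Nat.choose_succ_succ' n 1, Nat.choose_one_right, add_comm]

/-- A power series with summable terms at `x` tends to its constant term along `x q ^ n`. -/
theorem tendsto_tsum_mul_pow {a : ℕ → ℂ} {x q : ℂ} (hq : ‖q‖ < 1)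
    (h : Summable fun j => ‖a j * x ^ j‖) :
    Tendsto (fun n : ℕ => ∑' j, a j * (x * q ^ n) ^ j) atTop (𝓝 (a 0)) := by
  have hlim : ∑' j, (if j = 0 then a 0 else 0) = a 0 := tsum_ite_eq 0 _
  rw [← hlim]
  refine tendsto_tsum_of_dominated_convergence h (fun j => ?_) (Eventually.of_forall fun n j => ?_)
  · rcases j with _ | j
    · simp
    · have h1 : Tendsto (fun n : ℕ => (q ^ n) ^ (j + 1)) atTop (𝓝 0) := by
        simpa using (tendsto_pow_atTop_nhds_zero_of_norm_lt_one hq).pow (j + 1)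
      simpa [mul_pow, mul_assoc] using (h1.const_mul (x ^ (j + 1))).const_mul (a (j + 1))
  · rw [mul_pow, ← mul_assoc, norm_mul]
    refine mul_le_of_le_one_right (norm_nonneg _) ?_
    rw [norm_pow, norm_pow]
    exact pow_le_one₀ (by positivity) (pow_le_one₀ (norm_nonneg _) hq.le)

theorem summable_norm_pow_choose_mul (x : ℂ) {q : ℂ} (hq : ‖q‖ < 1) :
    Summable fun j : ℕ => ‖q ^ j.choose 2 * x ^ j‖ := by
  -- The ratio test needs nonzero terms; a zero term forces q = 0 or x = 0, and then everything from
  -- j = 2 on vanishes.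
  by_cases h0 : ∃ j : ℕ, q ^ j.choose 2 * x ^ j = 0
  · obtain ⟨j, hj⟩ := h0
    have hz : q = 0 ∨ x = 0 := by
      rcases mul_eq_zero.1 hj with h | h
      · exact .inl (eq_zero_of_pow_eq_zero h)
      · exact .inr (eq_zero_of_pow_eq_zero h)
    refine summable_of_ne_finset_zero (s := range 2) fun j hj => ?_
    have : 2 ≤ j := not_lt.1 (by simpa only [mem_range] using hj)
    rcases hz with rfl | rfl
    · simp [(Nat.choose_pos this).ne']
    · simp [show j ≠ 0 by omega]
  · push Not at h0
    refine summable_of_ratio_test_tendsto_lt_one (l := 0) one_pos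
      (Eventually.of_forall fun j => norm_ne_zero_iff.2 (h0 j)) ?_
    have h1 : Tendsto (fun n : ℕ => ‖q ^ n * x‖) atTop (𝓝 0) := by
      simpa using ((tendsto_pow_atTop_nhds_zero_of_norm_lt_one hq).mul_const x).norm
    refine h1.congr fun n => ?_
    rw [norm_norm, norm_norm, ← norm_div]
    congr 1
    rw [eq_div_iff (h0 n), choose_succ_two]
    ring

theorem Summable.norm_div_qPoch {f : ℕ → ℂ} (hf : Summable fun j => ‖f j‖) {a q : ℂ}
    (ha : ‖a‖ < 1) (hq : ‖q‖ < 1) (k : ℕ) : Summable fun j => ‖f j / qPoch a q (j + k)‖ := by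
  obtain ⟨C, hC0, hC⟩ := exists_norm_qPoch_inv_le ha hq
  refine .of_nonneg_of_le (fun _ => norm_nonneg _) (fun j => ?_) (hf.mul_right C)
  rw [div_eq_mul_inv, norm_mul]
  exact mul_le_mul_of_nonneg_left (hC _) (norm_nonneg _)

theorem summable_euler_two (x : ℂ) {q : ℂ} (hq : ‖q‖ < 1) :
    Summable fun j : ℕ => ‖q ^ j.choose 2 * x ^ j / qPoch q q j‖ :=
  (summable_norm_pow_choose_mul x hq).norm_div_qPoch hq hq 0

/-- The series satisfies f(y) = (1 + y) f(yq); iterating gives f(x) = (-x;q)_n f(xq^n), and f(xq^n)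
→ 1. -/
theorem tsum_euler_two (x : ℂ) {q : ℂ} (hq : ‖q‖ < 1) :
    ∑' j : ℕ, q ^ j.choose 2 * x ^ j / qPoch q q j = qPochInf (-x) q := by
  set f : ℂ → ℂ := fun x => ∑' j : ℕ, q ^ j.choose 2 * x ^ j / qPoch q q j with hf
  have hstep (y : ℂ) : f y = (1 + y) * f (y * q) := by
    have hs (z : ℂ) := (summable_euler_two z hq).of_norm
    have hs' := (hs (y * q)).mul_left y
    simp only [hf]
    rw [add_mul, one_mul, ← tsum_mul_left, (hs y).tsum_eq_zero_add, (hs (y * q)).tsum_eq_zero_add,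
      add_assoc, ← Summable.tsum_add ((summable_nat_add_iff 1).2 (hs (y * q))) hs']
    simp only [pow_zero]
    congr 1
    refine tsum_congr fun j => ?_
    have h1 := qPoch_ne_zero hq hq j
    have h2 := one_sub_ne_zero_of_norm_lt_one (norm_mul_pow_lt_one hq hq j)
    rw [choose_succ_two, qPoch_succ]
    field_simp
    ring
  have hiter (n : ℕ) : f x = qPoch (-x) q n * f (x * q ^ n) := by
    induction n with
    | zero => simp
    | succ n ih => rw [ih, hstep (x * q ^ n), qPoch_succ]; ring_nf
  have hlim : Tendsto (fun n : ℕ => f (x * q ^ n)) atTop (𝓝 1) := by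
    have := tendsto_tsum_mul_pow (a := fun j => q ^ j.choose 2 / qPoch q q j) (x := x) hq
      (by simpa only [div_mul_eq_mul_div] using summable_euler_two x hq)
    simpa [hf, div_mul_eq_mul_div] using this
  have := (tendsto_qPoch (-x) q hq).mul hlim
  rw [mul_one] at this
  exact tendsto_nhds_unique (tendsto_const_nhds.congr hiter) this

theorem summable_euler_one {x q : ℂ} (hx : ‖x‖ < 1) (hq : ‖q‖ < 1) :
    Summable fun j : ℕ => ‖x ^ j / qPoch q q j‖ :=
  Summable.norm_div_qPoch (by simpa using summable_geometric_of_lt_one (norm_nonneg x) hx) hq hq 0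

/-- Same method, with the functional equation (1 - y) f(y) = f(yq). -/
theorem qPochInf_mul_tsum_euler_one {x q : ℂ} (hx : ‖x‖ < 1) (hq : ‖q‖ < 1) :
    qPochInf x q * ∑' j : ℕ, x ^ j / qPoch q q j = 1 := by
  set f : ℂ → ℂ := fun x => ∑' j : ℕ, x ^ j / qPoch q q j with hf
  have hstep (y : ℂ) (hy : ‖y‖ < 1) : (1 - y) * f y = f (y * q) := by
    have hs := (summable_euler_one hy hq).of_norm
    have hs2 := (summable_euler_one (by simpa using norm_mul_pow_lt_one hy hq 1 : ‖y * q‖ < 1)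
      hq).of_norm
    have hs' := hs.mul_left y
    rw [sub_mul, one_mul, sub_eq_iff_eq_add]
    simp only [hf]
    rw [← tsum_mul_left, hs.tsum_eq_zero_add, hs2.tsum_eq_zero_add,
      add_assoc, ← Summable.tsum_add ((summable_nat_add_iff 1).2 hs2) hs']
    congr 1
    refine tsum_congr fun j => ?_
    have h1 := qPoch_ne_zero hq hq j
    have h2 := one_sub_ne_zero_of_norm_lt_one (norm_mul_pow_lt_one hq hq j)
    rw [qPoch_succ]
    field_simp
    ring
  have hiter (n : ℕ) : qPoch x q n * f x = f (x * q ^ n) := by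
    induction n with
    | zero => simp
    | succ n ih =>
      rw [qPoch_succ, mul_right_comm, ih, mul_comm, hstep _ (norm_mul_pow_lt_one hx hq n), pow_succ,
        mul_assoc]
  have hlim : Tendsto (fun n : ℕ => f (x * q ^ n)) atTop (𝓝 1) := by
    have := tendsto_tsum_mul_pow (a := fun j => (qPoch q q j)⁻¹) (x := x) hq
      (by simpa only [inv_mul_eq_div] using summable_euler_one hx hq)
    simpa [hf, inv_mul_eq_div] using this
  exact tendsto_nhds_unique (((tendsto_qPoch x q hq).mul_const (f x)).congr hiter) hlim

/-! ### The series `∑ t ^ m (-1; q)_m` -/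

theorem summable_pow_mul_qPoch (a : ℂ) {t q : ℂ} (ht : ‖t‖ < 1) (hq : ‖q‖ < 1) :
    Summable fun m : ℕ => ‖t ^ m * qPoch a q m‖ := by
  obtain ⟨C, hC0, hC⟩ := exists_norm_qPoch_le a hq
  refine .of_nonneg_of_le (fun _ => norm_nonneg _) (fun j => ?_)
    ((summable_geometric_of_lt_one (norm_nonneg t) ht).mul_right C)
  rw [norm_mul, norm_pow]
  exact mul_le_mul_of_nonneg_left (hC _) (by positivity)

theorem one_sub_mul_tsum_pow_mul_qPoch {t q : ℂ} (ht : ‖t‖ < 1) (hq : ‖q‖ < 1) :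
    (1 - t) * ∑' m : ℕ, t ^ m * qPoch (-1) q m =
      1 + t * ∑' m : ℕ, (t * q) ^ m * qPoch (-1) q m := by
  have hs := (summable_pow_mul_qPoch (-1) ht hq).of_norm
  have hs2 := (summable_pow_mul_qPoch (-1)
    (by simpa using norm_mul_pow_lt_one ht hq 1 : ‖t * q‖ < 1) hq).of_norm
  rw [sub_mul, one_mul, sub_eq_iff_eq_add, add_assoc, ← mul_add, ← hs2.tsum_add hs,
    ← tsum_mul_left]
  conv_lhs => rw [hs.tsum_eq_zero_add]
  congr 1
  · simp
  refine tsum_congr fun m => ?_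
  rw [qPoch_succ]
  ring

theorem summable_pow_choose_div_qPoch {t q : ℂ} (ht : ‖t‖ < 1) (hq : ‖q‖ < 1) :
    Summable fun k : ℕ => ‖q ^ k.choose 2 * t ^ k / qPoch t q (k + 1)‖ :=
  (summable_norm_pow_choose_mul t hq).norm_div_qPoch ht hq 1

/-- Iterating (1 - t) f(t) = 1 + t f(tq) produces the right-hand partial sums; the remainder is
f(tq^n) → 1 times a coefficient tending to 0. -/
theorem tsum_pow_mul_qPoch_neg_one {t q : ℂ} (ht : ‖t‖ < 1) (hq : ‖q‖ < 1) :
    ∑' m : ℕ, t ^ m * qPoch (-1) q m = ∑' k : ℕ, q ^ k.choose 2 * t ^ k / qPoch t q (k + 1) := by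
  set f : ℂ → ℂ := fun t => ∑' m : ℕ, t ^ m * qPoch (-1) q m with hf
  have hiter (n : ℕ) : ∑ k ∈ range n, q ^ k.choose 2 * t ^ k / qPoch t q (k + 1) =
      f t - q ^ n.choose 2 * t ^ n / qPoch t q n * f (t * q ^ n) := by
    induction n with
    | zero => simp
    | succ n ih =>
      have h := one_sub_mul_tsum_pow_mul_qPoch (norm_mul_pow_lt_one ht hq n) hq
      have h1 := qPoch_ne_zero ht hq n
      have h2 := one_sub_ne_zero_of_norm_lt_one (norm_mul_pow_lt_one ht hq n)
      change (1 - t * q ^ n) * f (t * q ^ n) = 1 + t * q ^ n * f (t * q ^ n * q) at h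
      rw [sum_range_succ, ih, choose_succ_two, qPoch_succ, pow_succ q, ← mul_assoc t]
      field_simp
      linear_combination (-(q ^ n.choose 2 * t ^ n)) * h
  have hlim : Tendsto (fun n : ℕ => f (t * q ^ n)) atTop (𝓝 1) := by
    have := tendsto_tsum_mul_pow (a := fun j => qPoch (-1) q j) (x := t) hq
      (by simpa only [mul_comm] using summable_pow_mul_qPoch (-1) ht hq)
    simpa [hf, mul_comm] using this
  have hcoef : Tendsto (fun n : ℕ => q ^ n.choose 2 * t ^ n / qPoch t q n) atTop (𝓝 0) :=
    ((summable_norm_pow_choose_mul t hq).norm_div_qPoch ht hq 0).of_norm.tendsto_atTop_zero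
  have h1 := (tendsto_const_nhds (x := f t)).sub (hcoef.mul hlim)
  rw [zero_mul, sub_zero] at h1
  exact tendsto_nhds_unique (h1.congr fun n => (hiter n).symm)
    (summable_pow_choose_div_qPoch ht hq).of_norm.hasSum.tendsto_sum_nat


/-! ### A product of two series as a double sum split along the diagonal -/

theorem injective_diagonal_le : Function.Injective fun p : ℕ × ℕ => (p.1, p.1 + p.2) := by
  rintro ⟨a, b⟩ ⟨c, d⟩ h
  simp only [Prod.mk.injEq] at h ⊢
  omega

theorem injective_diagonal_gt : Function.Injective fun p : ℕ × ℕ => (p.1 + p.2 + 1, p.1) := by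
  rintro ⟨a, b⟩ ⟨c, d⟩ h
  simp only [Prod.mk.injEq] at h ⊢
  omega

theorem isCompl_range_diagonal :
    IsCompl (Set.range fun p : ℕ × ℕ => (p.1, p.1 + p.2))
      (Set.range fun p : ℕ × ℕ => (p.1 + p.2 + 1, p.1)) := by
  refine IsCompl.of_eq ?_ ?_
  · rw [Set.bot_eq_empty, Set.eq_empty_iff_forall_notMem]
    rintro _ ⟨⟨a, rfl⟩, b, hb⟩
    simp only [Prod.mk.injEq] at hb
    omega
  · rw [Set.top_eq_univ, Set.eq_univ_iff_forall]
    rintro ⟨x, y⟩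
    rcases le_or_gt x y with h | h
    · exact .inl ⟨(x, y - x), Prod.ext rfl (Nat.add_sub_of_le h)⟩
    · refine .inr ⟨(y, x - y - 1), Prod.ext ?_ rfl⟩
      change y + (x - y - 1) + 1 = x
      omega

theorem HasSum.split_diagonal {F : ℕ × ℕ → ℂ} {a b : ℂ}
    (h₁ : HasSum (fun p : ℕ × ℕ => F (p.1, p.1 + p.2)) a)
    (h₂ : HasSum (fun p : ℕ × ℕ => F (p.1 + p.2 + 1, p.1)) b) : HasSum F (a + b) :=
  (injective_diagonal_le.hasSum_range_iff.2 h₁).add_isCompl isCompl_range_diagonal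
    (injective_diagonal_gt.hasSum_range_iff.2 h₂)

/-- The diagonal is assigned to the first half, hence the shift by 1 in the second. -/
theorem hasSum_split_diagonal {e o : ℕ → ℂ} (he : Summable fun n => ‖e n‖)
    (ho : Summable fun n => ‖o n‖) :
    (Summable fun p : ℕ × ℕ => e p.1 * o (p.1 + p.2)) ∧
    (Summable fun p : ℕ × ℕ => o p.1 * e (p.1 + p.2 + 1)) ∧
    ∑' p : ℕ × ℕ, e p.1 * o (p.1 + p.2) + ∑' p : ℕ × ℕ, o p.1 * e (p.1 + p.2 + 1) =
      (∑' n, e n) * ∑' n, o n := by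
  have hs := summable_mul_of_summable_norm he ho
  have s₁ : Summable fun p : ℕ × ℕ => e p.1 * o (p.1 + p.2) := by
    simpa only [Function.comp_def] using hs.comp_injective injective_diagonal_le
  have s₂ : Summable fun p : ℕ × ℕ => e (p.1 + p.2 + 1) * o p.1 := by
    simpa only [Function.comp_def] using hs.comp_injective injective_diagonal_gt
  have h := HasSum.split_diagonal (F := fun p => e p.1 * o p.2) s₁.hasSum s₂.hasSum
  simp only [mul_comm (o _) (e _)]
  exact ⟨s₁, s₂, by rw [tsum_mul_tsum_of_summable_norm he ho, h.tsum_eq]⟩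

/-! ### The series over the smallest part -/

theorem norm_neg_sq_lt_one {q : ℂ} (hq : ‖q‖ < 1) : ‖-q ^ 2‖ < 1 := by
  rw [norm_neg]; exact norm_sq_lt_one hq

theorem qPochInf_neg_one_sq_ne_zero {q : ℂ} (hq : ‖q‖ < 1) : qPochInf (-1) (q ^ 2) ≠ 0 := by
  rw [qPochInf_eq_one_sub_mul _ (norm_sq_lt_one hq)]
  refine mul_ne_zero (by norm_num) ?_
  simpa using qPochInf_ne_zero (norm_neg_sq_lt_one hq) (norm_sq_lt_one hq)

theorem qPochInf_neg_one {q : ℂ} (hq : ‖q‖ < 1) :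
    qPochInf (-1) q = qPochInf (-1) (q ^ 2) * qPochInf (-q) (q ^ 2) := by
  simpa using qPochInf_eq_even_mul_odd (-1) hq

/-- The tail (-q^(2n+1);q)_∞ splits by parity; its even-exponent half (-q^(2n+2);q²)_∞ is exactly
what completes (-1;q²)_{n+1} to (-1;q²)_∞. -/
theorem qPochInf_neg_one_mul_smallest_part {q : ℂ} (hq : ‖q‖ < 1) (n : ℕ) :
    qPochInf (-1) (q ^ 2) * (qPoch (-q ^ (n + 1)) q n * qPochInf (-q ^ (2 * n + 1)) (q ^ 2)) =
      qPoch (-1) (q ^ 2) (n + 1) * qPochInf (-q ^ (n + 1)) q := by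
  have h1 := qPochInf_eq_qPoch_mul (-1) (norm_sq_lt_one hq) (n + 1)
  have h2 := qPochInf_eq_qPoch_mul (-q ^ (n + 1)) hq n
  have h3 := qPochInf_eq_even_mul_odd (-q ^ (2 * n + 1)) hq
  rw [show -q ^ (n + 1) * q ^ n = -q ^ (2 * n + 1) by ring, h3,
    show -q ^ (2 * n + 1) * q = -1 * (q ^ 2) ^ (n + 1) by ring] at h2
  rw [h1, h2]
  ring

theorem summable_smallest_part {q : ℂ} (hq : ‖q‖ < 1) :
    Summable fun n : ℕ =>
      q ^ n * qPoch (-q ^ (n + 1)) q n * qPochInf (-q ^ (2 * n + 1)) (q ^ 2) := by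
  obtain ⟨C, hC0, hC⟩ := exists_norm_qPoch_le (-1) (norm_sq_lt_one hq)
  have h2 : ∃ D, 0 ≤ D ∧ ∀ n : ℕ, ‖qPochInf (-q ^ (n + 1)) q‖ ≤ D := by
    refine exists_norm_le_of_tendsto (l := 1) ?_
    have := tendsto_tsum_mul_pow (a := fun j => q ^ j.choose 2 / qPoch q q j) (x := q) hq
      (by simpa only [div_mul_eq_mul_div] using summable_euler_two q hq)
    simpa [div_mul_eq_mul_div, tsum_euler_two _ hq, ← pow_succ'] using this
  obtain ⟨D, hD0, hD⟩ := h2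
  refine (((summable_geometric_of_lt_one (norm_nonneg q) hq).mul_right
    (C * D)).mul_left ‖(qPochInf (-1) (q ^ 2))⁻¹‖).of_norm_bounded fun n => ?_
  have h : q ^ n * qPoch (-q ^ (n + 1)) q n * qPochInf (-q ^ (2 * n + 1)) (q ^ 2) =
      (qPochInf (-1) (q ^ 2))⁻¹ * (q ^ n * (qPoch (-1) (q ^ 2) (n + 1) *
        qPochInf (-q ^ (n + 1)) q)) := by
    have h0 := qPochInf_neg_one_sq_ne_zero hq
    rw [← qPochInf_neg_one_mul_smallest_part hq]
    field_simp
  rw [h, norm_mul, norm_mul, norm_mul, norm_pow]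
  gcongr
  · exact hC _
  · exact hD _

theorem tsum_expand_neg_qPochInf {q : ℂ} (hq : ‖q‖ < 1) :
    HasSum (fun j : ℕ => q ^ j.choose 2 / qPoch q q j *
      ∑' m : ℕ, (q ^ (j + 1)) ^ m * qPoch (-1) (q ^ 2) m)
      (∑' m : ℕ, q ^ m * qPoch (-1) (q ^ 2) m * qPochInf (-q ^ m) q) := by
  have hs : Summable fun p : ℕ × ℕ => q ^ p.1 * qPoch (-1) (q ^ 2) p.1 *
      (q ^ p.2.choose 2 * (q ^ p.1) ^ p.2 / qPoch q q p.2) := by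
    -- Since |(q^m)^j| ≤ 1, a product of two absolutely convergent series dominates, which permits
    -- exchanging the sums over m and j.
    refine ((summable_pow_mul_qPoch (-1) hq (norm_sq_lt_one hq)).mul_of_nonneg
      (summable_euler_two 1 hq) (fun _ => norm_nonneg _) (fun _ => norm_nonneg _)).of_norm_bounded
      fun p => ?_
    rw [norm_mul]
    refine mul_le_mul_of_nonneg_left ?_ (norm_nonneg _)
    rw [mul_comm, mul_comm (q ^ _) (1 ^ _), mul_div_assoc, mul_div_assoc, norm_mul, norm_mul]
    refine mul_le_mul_of_nonneg_right ?_ (norm_nonneg _)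
    simpa using pow_le_one₀ (by positivity) (pow_le_one₀ (norm_nonneg _) hq.le)
  have h1 : ∑' m : ℕ, q ^ m * qPoch (-1) (q ^ 2) m * qPochInf (-q ^ m) q =
      ∑' p : ℕ × ℕ, q ^ p.1 * qPoch (-1) (q ^ 2) p.1 *
        (q ^ p.2.choose 2 * (q ^ p.1) ^ p.2 / qPoch q q p.2) := by
    rw [hs.tsum_prod]
    refine tsum_congr fun m => ?_
    simp only [tsum_mul_left, tsum_euler_two _ hq]
  rw [h1]
  have h2 := (Equiv.prodComm ℕ ℕ).hasSum_iff.2 hs.hasSum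
  refine h2.prod_fiberwise fun j => ?_
  have h3 : ‖q ^ (j + 1)‖ < 1 := by
    rw [norm_pow]; exact pow_lt_one₀ (norm_nonneg _) hq (by omega)
  refine ((summable_pow_mul_qPoch (-1) h3 (norm_sq_lt_one hq)).of_norm.hasSum.mul_left
    (q ^ j.choose 2 / qPoch q q j)).congr_fun fun m => ?_
  simp only [Function.comp_apply, Equiv.prodComm_apply, Prod.swap_prod_mk]
  ring

/-- Here (q;q)_{2l} = (q;q²)_l (q²;q²)_l, and (q;q²)_l merges with (q^(2l+1);q²)_{k+1} into
(q;q²)_{l+k+1}. -/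
theorem even_term_eq (q : ℂ) (l k : ℕ) :
    q ^ (2 * l).choose 2 / qPoch q q (2 * l) * ((q ^ 2) ^ k.choose 2 * (q ^ (2 * l + 1)) ^ k /
      qPoch (q ^ (2 * l + 1)) (q ^ 2) (k + 1)) =
    (q ^ 2) ^ l.choose 2 / qPoch (q ^ 2) (q ^ 2) l *
      ((q ^ 2) ^ (l + k).choose 2 * q ^ (l + k) / qPoch q (q ^ 2) (l + k + 1)) := by
  rw [add_assoc l k 1, qPoch_add q (q ^ 2) l, qPoch_two_mul, div_mul_div_comm, div_mul_div_comm,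
    show q ^ (2 * l + 1) = q * (q ^ 2) ^ l by ring, ← pow_two q]
  congr 1
  · simp only [← pow_mul, ← pow_add, ← pow_succ']
    congr 1
    have h1 := two_mul_choose_two_add (2 * l)
    have h2 := two_mul_choose_two_add l
    have h3 := two_mul_choose_two_add k
    have h4 := two_mul_choose_two_add (l + k)
    nlinarith
  · ring

/-- For odd index the roles swap: (q²;q²)_l is the factor that merges, into (q²;q²)_{l+k+1}. -/
theorem odd_term_eq (q : ℂ) (l k : ℕ) :
    q ^ (2 * l + 1).choose 2 / qPoch q q (2 * l + 1) *
      ((q ^ 2) ^ k.choose 2 * (q ^ (2 * l + 1 + 1)) ^ k /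
        qPoch (q ^ (2 * l + 1 + 1)) (q ^ 2) (k + 1)) =
    (q ^ 2) ^ l.choose 2 * q ^ l / qPoch q (q ^ 2) (l + 1) *
      ((q ^ 2) ^ (l + k + 1).choose 2 / qPoch (q ^ 2) (q ^ 2) (l + k + 1)) := by
  rw [add_assoc l k 1, qPoch_add (q ^ 2) (q ^ 2) l, qPoch_succ q, qPoch_succ q, qPoch_two_mul,
    div_mul_div_comm, div_mul_div_comm,
    show q ^ (2 * l + 1 + 1) = q ^ 2 * (q ^ 2) ^ l by ring, ← pow_two q]
  congr 1
  · simp only [← pow_mul, ← pow_add]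
    congr 1
    have h1 := two_mul_choose_two_add (2 * l + 1)
    have h2 := two_mul_choose_two_add l
    have h3 := two_mul_choose_two_add k
    have h4 := two_mul_choose_two_add (l + (k + 1))
    nlinarith
  · ring

theorem tsum_pow_mul_qPoch_mul_qPochInf {q : ℂ} (hq : ‖q‖ < 1) :
    ∑' m : ℕ, q ^ m * qPoch (-1) (q ^ 2) m * qPochInf (-q ^ m) q =
      qPochInf (-1) (q ^ 2) * ∑' m : ℕ, q ^ m * qPoch (-1) (q ^ 2) m := by
  have hq2 := norm_sq_lt_one hq
  set e : ℕ → ℂ := fun l => (q ^ 2) ^ l.choose 2 / qPoch (q ^ 2) (q ^ 2) l with he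
  set o : ℕ → ℂ := fun l => (q ^ 2) ^ l.choose 2 * q ^ l / qPoch q (q ^ 2) (l + 1) with ho
  have hse : Summable fun l => ‖e l‖ := by simpa [he] using summable_euler_two 1 hq2
  have hso : Summable fun l => ‖o l‖ := summable_pow_choose_div_qPoch hq hq2
  have hte : ∑' l, e l = qPochInf (-1) (q ^ 2) := by simpa [he] using tsum_euler_two 1 hq2
  have hto : ∑' l, o l = ∑' m : ℕ, q ^ m * qPoch (-1) (q ^ 2) m :=
    (tsum_pow_mul_qPoch_neg_one hq hq2).symm
  obtain ⟨s₁, s₂, h⟩ := hasSum_split_diagonal hse hso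
  have hK (j : ℕ) : HasSum (fun k : ℕ => q ^ j.choose 2 / qPoch q q j *
      ((q ^ 2) ^ k.choose 2 * (q ^ (j + 1)) ^ k / qPoch (q ^ (j + 1)) (q ^ 2) (k + 1)))
      (q ^ j.choose 2 / qPoch q q j * ∑' m : ℕ, (q ^ (j + 1)) ^ m * qPoch (-1) (q ^ 2) m) := by
    have h3 : ‖q ^ (j + 1)‖ < 1 := by
      rw [norm_pow]; exact pow_lt_one₀ (norm_nonneg _) hq (by omega)
    rw [tsum_pow_mul_qPoch_neg_one h3 hq2]
    exact (summable_pow_choose_div_qPoch h3 hq2).of_norm.hasSum.mul_left _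
  have t₁ := s₁.hasSum.prod_fiberwise fun l => (hK (2 * l)).congr_fun fun k =>
    (even_term_eq q l k).symm
  have t₂ := s₂.hasSum.prod_fiberwise fun l => (hK (2 * l + 1)).congr_fun fun k =>
    (odd_term_eq q l k).symm
  rw [← hte, ← hto, ← h]
  have t := HasSum.even_add_odd (f := fun j : ℕ => q ^ j.choose 2 / qPoch q q j *
    ∑' m : ℕ, (q ^ (j + 1)) ^ m * qPoch (-1) (q ^ 2) m) t₁ t₂
  exact (tsum_expand_neg_qPochInf hq).unique t

/-- The series over the smallest part, in terms of `∑ q ^ m (-1; q²)_m`. -/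
theorem qPochInf_add_tsum_smallest_part {q : ℂ} (hq : ‖q‖ < 1) :
    qPochInf (-q) (q ^ 2) + q * ∑' n : ℕ,
        q ^ n * qPoch (-q ^ (n + 1)) q n * qPochInf (-q ^ (2 * n + 1)) (q ^ 2) =
      ∑' m : ℕ, q ^ m * qPoch (-1) (q ^ 2) m := by
  have h0 := qPochInf_neg_one_sq_ne_zero hq
  refine mul_left_cancel₀ h0 ?_
  rw [← tsum_pow_mul_qPoch_mul_qPochInf hq]
  -- The terms m = n + 1 give the smallest-part series; the term m = 0 is (-1;q)_∞ and accounts for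
  -- (-q;q²)_∞.
  have hterm (n : ℕ) : q ^ (n + 1) * qPoch (-1) (q ^ 2) (n + 1) * qPochInf (-q ^ (n + 1)) q =
      qPochInf (-1) (q ^ 2) * q *
        (q ^ n * qPoch (-q ^ (n + 1)) q n * qPochInf (-q ^ (2 * n + 1)) (q ^ 2)) := by
    rw [mul_assoc, ← qPochInf_neg_one_mul_smallest_part hq]
    ring
  have hs : Summable fun m : ℕ => q ^ m * qPoch (-1) (q ^ 2) m * qPochInf (-q ^ m) q := by
    refine (summable_nat_add_iff 1).1 ?_
    simp only [hterm]
    exact (summable_smallest_part hq).mul_left _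
  rw [hs.tsum_eq_zero_add]
  simp only [hterm]
  rw [tsum_mul_left]
  simp only [pow_zero, qPoch_zero, one_mul, qPochInf_neg_one hq]
  ring


/-! ### The bilateral series of the mock theta function -/

theorem summable_norm_zpow_sq {q : ℂ} (hq : ‖q‖ < 1) :
    Summable fun n : ℤ => ‖q ^ (n ^ 2)‖ := by
  have h : Summable fun n : ℕ => ‖q ^ ((n : ℤ) ^ 2)‖ := by
    refine (summable_geometric_of_lt_one (norm_nonneg q) hq).of_nonneg_of_le
      (fun _ => norm_nonneg _) fun n => ?_
    rw [← Nat.cast_pow, zpow_natCast, norm_pow]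
    exact pow_le_pow_of_le_one (norm_nonneg _) hq.le (Nat.le_self_pow two_ne_zero n)
  exact .of_nat_of_neg h (by simpa only [neg_sq] using h)

/-- The shear `(n, j) ↦ (n + j, j)` of `ℤ × ℕ`. -/
def shearIntNat : ℤ × ℕ ≃ ℤ × ℕ where
  toFun p := (p.1 + p.2, p.2)
  invFun p := (p.1 - p.2, p.2)
  left_inv p := by simp
  right_inv p := by simp

/-- Expanding the infinite product by Euler and completing the square, the exponents combine into (n
+ j)² + j; the shear then decouples the two sums. -/
theorem hasSum_zpow_sq_mul_qPochInf {q : ℂ} (hq0 : q ≠ 0) (hq : ‖q‖ < 1) {w : ℂ} (hw : ‖w‖ ≤ 1) :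
    HasSum (fun n : ℤ => q ^ (n ^ 2) * qPochInf (-(w * q ^ (2 * n + 2))) (q ^ 2))
      ((∑' n : ℤ, q ^ (n ^ 2)) * ∑' j : ℕ, (w * q) ^ j / qPoch (q ^ 2) (q ^ 2) j) := by
  have hq2 := norm_sq_lt_one hq
  have hwq : ‖w * q‖ < 1 := by
    rw [norm_mul]; exact mul_lt_one_of_nonneg_of_lt_one_right hw (norm_nonneg _) hq
  have hE : Summable fun j : ℕ => ‖(w * q) ^ j / qPoch (q ^ 2) (q ^ 2) j‖ :=
    Summable.norm_div_qPoch (by simpa using summable_geometric_of_lt_one (norm_nonneg _) hwq)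
      hq2 hq2 0
  rw [tsum_mul_tsum_of_summable_norm (summable_norm_zpow_sq hq) hE]
  refine (shearIntNat.hasSum_iff.2 (summable_mul_of_summable_norm
    (summable_norm_zpow_sq hq) hE).hasSum).prod_fiberwise fun n => ?_
  rw [← tsum_euler_two _ hq2]
  refine ((summable_euler_two _ hq2).of_norm.hasSum.mul_left _).congr_fun fun j => ?_
  have h : q ^ ((n + j) ^ 2) * (w * q) ^ j =
      q ^ (n ^ 2) * ((q ^ 2) ^ j.choose 2 * (w * q ^ (2 * n + 2)) ^ j) := by
    have h1 : (2 * j.choose 2 + j : ℤ) = j ^ 2 := by exact_mod_cast two_mul_choose_two_add j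
    simp only [← zpow_natCast, mul_zpow, ← zpow_mul]
    rw [mul_left_comm (q ^ (n ^ 2)), mul_left_comm, mul_left_comm (q ^ (n ^ 2)), ← zpow_add₀ hq0,
      ← zpow_add₀ hq0, mul_left_comm, ← zpow_add₀ hq0]
    congr 2
    push_cast
    linear_combination (-1 : ℤ) * h1
  simp only [Function.comp_apply, shearIntNat, Equiv.coe_fn_mk]
  rw [← mul_div_assoc, h, mul_div_assoc]

/-- Passing from m to m + 1 contributes q^(2m+1) (1 + w q^(-2m)) = q (q^(2m) + w). This form shows
the vanishing at w = -1 (factor k = 0) and gives q^m (-1;q²)_m at w = 1. -/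
theorem zpow_neg_sq_mul_qPochInf {q : ℂ} (hq0 : q ≠ 0) (hq : ‖q‖ < 1) (w : ℂ) (m : ℕ) :
    q ^ ((-m : ℤ) ^ 2) * qPochInf (-(w * q ^ (2 * (-m : ℤ) + 2))) (q ^ 2) =
      (∏ k ∈ range m, q * ((q ^ 2) ^ k + w)) * qPochInf (-(w * q ^ 2)) (q ^ 2) := by
  induction m with
  | zero => simp
  | succ m ih =>
    rw [prod_range_succ, mul_right_comm, ← ih,
      qPochInf_eq_one_sub_mul (-(w * q ^ (2 * (-(m + 1 : ℕ) : ℤ) + 2))) (norm_sq_lt_one hq)]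
    have h1 : q ^ (2 * (-(m + 1 : ℕ) : ℤ) + 2) * q ^ 2 = q ^ (2 * (-m : ℤ) + 2) := by
      rw [← zpow_natCast q 2, ← zpow_add₀ hq0]
      congr 1
      push_cast
      ring
    have h2 : q ^ ((-(m + 1 : ℕ) : ℤ) ^ 2) = q ^ ((-m : ℤ) ^ 2) * q * (q ^ 2) ^ m := by
      rw [← pow_mul, ← zpow_natCast q (2 * m), ← zpow_add_one₀ hq0, ← zpow_add₀ hq0]
      congr 1
      push_cast
      ring
    have h3 : (q ^ 2) ^ m * q ^ (2 * (-(m + 1 : ℕ) : ℤ) + 2) = 1 := by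
      rw [← pow_mul, ← zpow_natCast q (2 * m), ← zpow_add₀ hq0, ← zpow_zero q]
      congr 1
      push_cast
      ring
    rw [neg_mul, mul_assoc w, h1, h2]
    linear_combination (q ^ ((-m : ℤ) ^ 2) * q * w *
      qPochInf (-(w * q ^ (2 * (-m : ℤ) + 2))) (q ^ 2)) * h3

theorem zpow_sq_mul_qPochInf_natCast {q : ℂ} (hq : ‖q‖ < 1) {w : ℂ} (hw : ‖w‖ ≤ 1) (n : ℕ) :
    q ^ ((n : ℤ) ^ 2) * qPochInf (-(w * q ^ (2 * (n : ℤ) + 2))) (q ^ 2) =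
      qPochInf (-(w * q ^ 2)) (q ^ 2) * (q ^ (n ^ 2) / qPoch (-(w * q ^ 2)) (q ^ 2) n) := by
  have h0 : ‖-(w * q ^ 2)‖ < 1 := by
    rw [norm_neg, norm_mul]
    exact mul_lt_one_of_nonneg_of_lt_one_right hw (norm_nonneg _) (norm_sq_lt_one hq)
  have h1 : q ^ (2 * (n : ℤ) + 2) = q ^ 2 * (q ^ 2) ^ n := by
    rw [← pow_mul, ← pow_add, ← zpow_natCast]
    congr 1
    push_cast
    ring
  have h2 := qPoch_ne_zero h0 (norm_sq_lt_one hq) n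
  rw [qPochInf_eq_qPoch_mul (-(w * q ^ 2)) (norm_sq_lt_one hq) n, h1, ← Nat.cast_pow, zpow_natCast,
    neg_mul, mul_assoc w]
  field_simp

theorem Summable.tsum_int_eq_add {f : ℤ → ℂ} (h : Summable f) :
    ∑' n, f n = ∑' n : ℕ, f n + ∑' n : ℕ, f (-(n + 1)) := by
  have i₁ : Function.Injective fun n : ℕ => (n : ℤ) := Nat.cast_injective
  have i₂ : Function.Injective fun n : ℕ => (-(n + 1) : ℤ) := fun a b hab => by simpa using hab
  exact tsum_of_nat_of_neg_add_one (h.comp_injective i₁) (h.comp_injective i₂)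

theorem tsum_zpow_sq_mul_qPochInf {q : ℂ} (hq0 : q ≠ 0) (hq : ‖q‖ < 1) {w : ℂ} (hw : ‖w‖ ≤ 1) :
    qPochInf (-(w * q ^ 2)) (q ^ 2) *
      (∑' n : ℕ, q ^ (n ^ 2) / qPoch (-(w * q ^ 2)) (q ^ 2) n +
        ∑' m : ℕ, ∏ k ∈ range (m + 1), q * ((q ^ 2) ^ k + w)) =
      (∑' n : ℤ, q ^ (n ^ 2)) * ∑' j : ℕ, (w * q) ^ j / qPoch (q ^ 2) (q ^ 2) j := by
  have h := hasSum_zpow_sq_mul_qPochInf hq0 hq hw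
  rw [← h.tsum_eq, h.summable.tsum_int_eq_add, mul_add, ← tsum_mul_left, ← tsum_mul_left]
  congr 1
  · exact tsum_congr fun n => (zpow_sq_mul_qPochInf_natCast hq hw n).symm
  · refine tsum_congr fun m => ?_
    have := zpow_neg_sq_mul_qPochInf hq0 hq w (m + 1)
    rw [mul_comm, ← this]
    push_cast
    rfl

theorem summable_mockPhi {q : ℂ} (hq : ‖q‖ < 1) :
    Summable fun n : ℕ => q ^ (n ^ 2) / qPoch (-q ^ 2) (q ^ 2) n := by
  refine (Summable.norm_div_qPoch (f := fun n => q ^ (n ^ 2)) ?_ (norm_neg_sq_lt_one hq)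
    (norm_sq_lt_one hq) 0).of_norm
  refine (summable_geometric_of_lt_one (norm_nonneg q) hq).of_nonneg_of_le
      (fun _ => norm_nonneg _) fun n => ?_
  rw [norm_pow]
  exact pow_le_pow_of_le_one (norm_nonneg _) hq.le (Nat.le_self_pow two_ne_zero n)

/-- The two halves of the bilateral series of `φ` add up to a theta product. -/
theorem mockPhi_add_tsum {q : ℂ} (hq : ‖q‖ < 1) :
    mockPhi q + ∑' m : ℕ, q ^ m * qPoch (-1) (q ^ 2) m - 1 =
      qPochInf (q ^ 2) (q ^ 2) * qPochInf (-q) (q ^ 2) ^ 3 := by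
  have hq2 := norm_sq_lt_one hq
  -- The bilateral series involves negative powers of q, so q = 0 is checked directly.
  rcases eq_or_ne q 0 with rfl | hq0
  · have h1 : mockPhi 0 = 1 := by
      rw [mockPhi, tsum_eq_single 0 fun n hn => by simp [hn]]
      simp
    have h2 : ∑' m : ℕ, (0 : ℂ) ^ m * qPoch (-1) (0 ^ 2) m = 1 := by
      rw [tsum_eq_single 0 fun n hn => by simp [hn]]
      simp
    rw [h1, h2]
    simp [qPochInf]
  have hm := tsum_zpow_sq_mul_qPochInf hq0 hq (w := 1) (by simp)
  have hj := tsum_zpow_sq_mul_qPochInf hq0 hq (w := -1) (by simp)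
  have hX := qPochInf_mul_tsum_euler_one hq hq2
  have hX' := qPochInf_mul_tsum_euler_one (x := -q) (by simpa using hq) hq2
  have hpos (m : ℕ) : ∏ k ∈ range (m + 1), q * ((q ^ 2) ^ k + 1) =
      q ^ (m + 1) * qPoch (-1) (q ^ 2) (m + 1) := by
    simp [prod_mul_distrib, qPoch, add_comm]
  have hneg (m : ℕ) : ∏ k ∈ range (m + 1), q * ((q ^ 2) ^ k + -1) = 0 :=
    prod_eq_zero (mem_range.2 m.succ_pos) (by simp)
  have hY (n : ℕ) : q ^ (n ^ 2) / qPoch (q ^ 2) (q ^ 2) n =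
      (q ^ 2) ^ n.choose 2 * q ^ n / qPoch (q ^ 2) (q ^ 2) n := by
    rw [← pow_mul, ← pow_add, two_mul_choose_two_add]
  simp only [hneg, neg_mul, one_mul, neg_neg, tsum_zero, add_zero, hY, tsum_euler_two q hq2] at hj
  simp only [hpos, one_mul] at hm
  have hH := (summable_pow_mul_qPoch (-1) hq hq2).of_norm.tsum_eq_zero_add
  simp only [pow_zero, qPoch_zero, mul_one] at hH
  have heuler := qPochInf_euler hq
  rw [← mockPhi] at hm
  rw [hH]
  set T := ∑' n : ℤ, q ^ (n ^ 2)
  set X := ∑' j : ℕ, q ^ j / qPoch (q ^ 2) (q ^ 2) j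
  set Y := ∑' j : ℕ, (-q) ^ j / qPoch (q ^ 2) (q ^ 2) j
  set S := ∑' m : ℕ, q ^ (m + 1) * qPoch (-1) (q ^ 2) (m + 1)
  set A := qPochInf (-q) (q ^ 2)
  set B := qPochInf (-q ^ 2) (q ^ 2)
  set D := qPochInf q (q ^ 2)
  set P := qPochInf (q ^ 2) (q ^ 2)
  -- The case w = -1 reads P A = T Y with A Y = 1, a special case of the Jacobi triple product.
  have hT : T = P * A ^ 2 := by linear_combination (-T) * hX' - A * hj
  -- Both X and A B are inverse to D, the latter by Euler's identity.
  have hX2 : X = A * B := by linear_combination (A * B) * hX - X * heuler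
  have hB : B ≠ 0 := qPochInf_ne_zero (norm_neg_sq_lt_one hq) hq2
  refine mul_left_cancel₀ hB ?_
  rw [hT, hX2] at hm
  linear_combination hm


/-! ### The generating function of the partitions -/

/-- The parts that may accompany the smallest part `n + 1`. -/
def admissibleParts (n : ℕ) : Set ℕ := {j | n + 1 < j ∧ (Even j → j ≤ 2 * (n + 1))}

/-- Beyond the smallest part n + 1, every part up to 2(n + 1) is allowed, giving the finite factor;
above that only odd parts are, giving the infinite one. -/
theorem hasProd_one_add_admissible {q : ℂ} (hq : ‖q‖ < 1) (n : ℕ) :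
    HasProd (fun j => 1 + (admissibleParts n).indicator (fun j => q ^ j) j)
      (qPoch (-q ^ (n + 2)) q (n + 1) * qPochInf (-q ^ (2 * (n + 1) + 1)) (q ^ 2)) := by
  have h₁ : HasProd (fun j => if n + 2 ≤ j ∧ j < 2 * (n + 1) + 1 then 1 + q ^ j else 1)
      (qPoch (-q ^ (n + 2)) q (n + 1)) := by
    have h : ∏ j ∈ Ico (n + 2) (2 * (n + 1) + 1),
        (if n + 2 ≤ j ∧ j < 2 * (n + 1) + 1 then 1 + q ^ j else 1) =
        qPoch (-q ^ (n + 2)) q (n + 1) := by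
      rw [prod_congr rfl fun j hj => if_pos (mem_Ico.1 hj), prod_Ico_eq_prod_range, qPoch,
        show 2 * (n + 1) + 1 - (n + 2) = n + 1 by omega]
      exact prod_congr rfl fun k _ => by ring
    rw [← h]
    exact hasProd_prod_of_ne_finset_one fun j hj => if_neg fun hj' => hj (mem_Ico.2 hj')
  have h₂ : HasProd (fun j => if Odd j ∧ 2 * (n + 1) < j then 1 + q ^ j else 1)
      (qPochInf (-q ^ (2 * (n + 1) + 1)) (q ^ 2)) := by
    have hi : Function.Injective fun k : ℕ => 2 * (n + 1) + 1 + 2 * k := fun a b hab => by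
      simpa using hab
    refine (hi.hasProd_iff fun j hj => if_neg fun hj' => hj ?_).1 ?_
    · obtain ⟨⟨k, rfl⟩, hk⟩ := hj'
      refine ⟨k - (n + 1), ?_⟩
      change 2 * (n + 1) + 1 + 2 * (k - (n + 1)) = 2 * k + 1
      omega
    · have hm : Multipliable fun k : ℕ => 1 + -(-q ^ (2 * (n + 1) + 1) * (q ^ 2) ^ k) :=
        multipliable_one_add_of_summable (summable_norm_neg_mul_pow _ (norm_sq_lt_one hq))
      simp only [qPochInf, sub_eq_add_neg]
      refine hm.hasProd.congr_fun fun k => ?_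
      have hodd : Odd (2 * (n + 1) + 1 + 2 * k) := ⟨n + 1 + k, by ring⟩
      simp only [Function.comp_apply]
      rw [if_pos ⟨hodd, by omega⟩]
      ring
  refine (h₁.mul h₂).congr_fun fun j => ?_
  by_cases hj : j ∈ admissibleParts n
  · rw [Set.indicator_of_mem hj]
    obtain ⟨h3, h4⟩ := hj
    by_cases h5 : j < 2 * (n + 1) + 1
    · rw [if_pos ⟨h3, h5⟩, if_neg (by omega), mul_one]
    · have h6 : Odd j := Nat.not_even_iff_odd.1 fun h => by have := h4 h; omega
      rw [if_neg (by omega), if_pos ⟨h6, by omega⟩, one_mul]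
  · rw [Set.indicator_of_notMem hj, add_zero, if_neg, if_neg, mul_one]
    · rintro ⟨h6, h7⟩
      exact hj ⟨by omega, fun h => absurd h (Nat.not_even_iff_odd.2 h6)⟩
    · rintro ⟨h6, h7⟩
      exact hj ⟨by omega, fun _ => by omega⟩

theorem summable_norm_pow {q : ℂ} (hq : ‖q‖ < 1) : Summable fun j : ℕ => ‖q ^ j‖ := by
  simpa using summable_geometric_of_lt_one (norm_nonneg q) hq

theorem hasSum_finset_admissible {q : ℂ} (hq : ‖q‖ < 1) (n : ℕ) :
    HasSum (fun T : {T : Finset ℕ // (T : Set ℕ) ⊆ admissibleParts n} => ∏ j ∈ T.1, q ^ j)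
      (qPoch (-q ^ (n + 2)) q (n + 1) * qPochInf (-q ^ (2 * (n + 1) + 1)) (q ^ 2)) := by
  have hs : Summable fun j => ‖(admissibleParts n).indicator (fun j => q ^ j) j‖ :=
    (summable_norm_pow hq).of_nonneg_of_le (fun _ => norm_nonneg _)
      fun j => norm_indicator_le_norm_self _ _
  have hs' := summable_finsetProd_of_summable_norm hs
  have h := hs'.hasSum
  rw [← tprod_one_add hs', (hasProd_one_add_admissible hq n).tprod_eq] at h
  -- In the expansion of ∏ (1 + f j) over finite sets, a set containing an inadmissible part
  -- contributes 0.
  have hsupp : Function.support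
      (fun T : Finset ℕ => ∏ j ∈ T, (admissibleParts n).indicator (fun j => q ^ j) j) ⊆
      {T | (T : Set ℕ) ⊆ admissibleParts n} := fun T hT j hj => by
    by_contra hj'
    exact hT (prod_eq_zero hj (Set.indicator_of_notMem hj' _))
  refine ((hasSum_subtype_iff_of_support_subset hsupp).2 h).congr_fun fun T => ?_
  exact prod_congr rfl fun j hj => (Set.indicator_of_mem (T.2 hj) _).symm

/-- The sets of parts of the partitions counted by `distinctEvenBoundedCount`. -/
def evenBoundedSets : Set (Finset ℕ) :=
  {S | 0 ∉ S ∧ ∃ s ∈ S, (∀ i ∈ S, s ≤ i) ∧ ∀ i ∈ S, Even i → i ≤ 2 * s}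

/-- The set of parts of a partition into distinct parts. -/
def partsFinset (p : Σ n : ℕ, {p : n.Partition // IsDistinctEvenBounded p}) : Finset ℕ :=
  ⟨p.2.1.parts, p.2.2.1⟩

theorem partsFinset_injective : Function.Injective partsFinset := by
  rintro ⟨n, p, hp⟩ ⟨m, p', hp'⟩ h
  have h1 : p.parts = p'.parts := congrArg Finset.val h
  obtain rfl : n = m := by rw [← p.parts_sum, ← p'.parts_sum, h1]
  obtain rfl : p = p' := Nat.Partition.ext h1
  rfl

theorem range_partsFinset : Set.range partsFinset = evenBoundedSets := by
  ext S
  constructor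
  · rintro ⟨⟨n, p, hp⟩, rfl⟩
    exact ⟨fun h => lt_irrefl 0 (p.parts_pos h), hp.2⟩
  · rintro ⟨h0, h⟩
    exact ⟨⟨S.val.sum, ⟨⟨S.val, fun {i} hi => Nat.pos_of_ne_zero fun hi0 => h0 (hi0 ▸ hi), rfl⟩,
      S.nodup, h⟩⟩, rfl⟩

/-- The set of parts with smallest part `n + 1` and given remaining parts. -/
def insertSmallest (x : Σ n : ℕ, {T : Finset ℕ // (T : Set ℕ) ⊆ admissibleParts n}) : Finset ℕ :=
  insert (x.1 + 1) x.2.1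

theorem smallest_notMem {n : ℕ} {T : Finset ℕ} (hT : (T : Set ℕ) ⊆ admissibleParts n) :
    n + 1 ∉ T := fun h => lt_irrefl _ (hT h).1

theorem insertSmallest_injective : Function.Injective insertSmallest := by
  rintro ⟨n, T, hT⟩ ⟨m, U, hU⟩ h
  change insert (n + 1) T = insert (m + 1) U at h
  obtain rfl : n = m := by
    have h1 : n + 1 ∈ insert (m + 1) U := h ▸ mem_insert_self _ _
    have h2 : m + 1 ∈ insert (n + 1) T := h ▸ mem_insert_self _ _
    rcases mem_insert.1 h1 with h1 | h1
    · omega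
    rcases mem_insert.1 h2 with h2 | h2
    · omega
    have h3 := (hU h1).1
    have h4 := (hT h2).1
    omega
  obtain rfl : T = U := by
    rw [← erase_insert (smallest_notMem hT), h, erase_insert (smallest_notMem hU)]
  rfl

theorem range_insertSmallest : Set.range insertSmallest = evenBoundedSets := by
  ext S
  constructor
  · rintro ⟨⟨n, T, hT⟩, rfl⟩
    refine ⟨fun h => ?_, n + 1, mem_insert_self _ _, fun i hi => ?_, fun i hi he => ?_⟩
    · rcases mem_insert.1 h with h | h
      · omega
      · exact absurd (hT h).1 (by omega)
    · rcases mem_insert.1 hi with h | h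
      · exact h.ge
      · exact (hT h).1.le
    · rcases mem_insert.1 hi with h | h
      · change i = n + 1 at h
        omega
      · exact (hT h).2 he
  · rintro ⟨h0, s, hs, hle, heven⟩
    obtain ⟨n, rfl⟩ : ∃ n, s = n + 1 :=
      Nat.exists_eq_succ_of_ne_zero fun h => h0 (h ▸ hs)
    refine ⟨⟨n, S.erase (n + 1), fun j hj => ?_⟩, insert_erase hs⟩
    obtain ⟨hne, hj⟩ := mem_erase.1 (mem_coe.1 hj)
    exact ⟨lt_of_le_of_ne (hle j hj) hne.symm, heven j hj⟩

/-- `partsFinset` and `insertSmallest` are injective with the same range `evenBoundedSets`, so the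
absolutely convergent sum of ∏ q^j over it may be fibred either by the partitioned number or by the
smallest part. -/
theorem hasSum_distinctEvenBoundedCount {q : ℂ} (hq : ‖q‖ < 1) :
    HasSum (fun n : ℕ => (distinctEvenBoundedCount n : ℂ) * q ^ n)
      (∑' n : ℕ, q ^ (n + 1) * qPoch (-q ^ (n + 2)) q (n + 1) *
        qPochInf (-q ^ (2 * (n + 1) + 1)) (q ^ 2)) := by
  set W : Finset ℕ → ℂ := fun S => ∏ j ∈ S, q ^ j with hW
  have hsW : Summable W := summable_finsetProd_of_summable_norm (summable_norm_pow hq)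
  have hZ := (hsW.comp_injective insertSmallest_injective).hasSum
  have hfib := hZ.sigma (g := fun n : ℕ => q ^ (n + 1) * qPoch (-q ^ (n + 2)) q (n + 1) *
      qPochInf (-q ^ (2 * (n + 1) + 1)) (q ^ 2)) fun n => by
    simp only [mul_assoc (q ^ (n + 1))]
    refine ((hasSum_finset_admissible hq n).mul_left (q ^ (n + 1))).congr_fun fun T => ?_
    exact prod_insert (smallest_notMem T.2)
  rw [hfib.tsum_eq]
  have hY : HasSum (W ∘ partsFinset) (∑' x, (W ∘ insertSmallest) x) := by
    rw [← partsFinset_injective.hasSum_range_iff, range_partsFinset, ← range_insertSmallest]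
    exact insertSmallest_injective.hasSum_range_iff.2 hZ
  refine hY.sigma fun n => ?_
  have hw (p : {p : n.Partition // IsDistinctEvenBounded p}) :
      (W ∘ partsFinset) ⟨n, p⟩ = q ^ n := by
    simp only [Function.comp_apply, hW]
    rw [prod_pow_eq_pow_sum _ (fun j => j)]
    congr 1
    exact (congrArg Multiset.sum (Multiset.map_id' _)).trans p.1.parts_sum
  simp only [hw]
  have := Fintype.ofFinite {p : n.Partition // IsDistinctEvenBounded p}
  have h := hasSum_fintype fun _ : {p : n.Partition // IsDistinctEvenBounded p} => q ^ n
  rwa [sum_const, card_univ, ← Nat.card_eq_fintype_card, nsmul_eq_mul] at h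

end

theorem theorem4p2 (q : ℂ) (hq : ‖q‖ < 1) :
    Summable (fun n : ℕ => q ^ (n ^ 2) / qPoch (-q ^ 2) (q ^ 2) n) ∧
    Summable (fun n : ℕ =>
      q ^ n * qPoch (-q ^ (n + 1)) q n * qPochInf (-q ^ (2 * n + 1)) (q ^ 2)) ∧
    1 + q / qPochInf (-q) (q ^ 2) * ∑' n : ℕ,
        q ^ n * qPoch (-q ^ (n + 1)) q n * qPochInf (-q ^ (2 * n + 1)) (q ^ 2) =
      (1 - mockPhi q) / qPochInf (-q) (q ^ 2) +
        qPochInf (q ^ 2) (q ^ 2) * qPochInf (-q) (q ^ 2) ^ 2 ∧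
    HasSum (fun n : ℕ => (distinctEvenBoundedCount n : ℂ) * q ^ n)
      (∑' n : ℕ, q ^ (n + 1) * qPoch (-q ^ (n + 2)) q (n + 1) *
        qPochInf (-q ^ (2 * (n + 1) + 1)) (q ^ 2)) := by
  refine ⟨summable_mockPhi hq, summable_smallest_part hq, ?_, hasSum_distinctEvenBoundedCount hq⟩
  have h0 : qPochInf (-q) (q ^ 2) ≠ 0 :=
    qPochInf_ne_zero (by rwa [norm_neg]) (norm_sq_lt_one hq)
  have h1 := qPochInf_add_tsum_smallest_part hq
  have h2 := mockPhi_add_tsum hq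
  field_simp
  linear_combination h1 + h2
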